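/- Let $n,m\ge 1$, let $\Omega\subset\mathbb{R}^n$ be open and let $u=(u^1,\dots,u^m):\Omega\to\mathbb{R}^m$ be a $C^\infty$ map whose graph $M=\{(x,u(x)):x\in\Omega\}\subset\mathbb{R}^{n+m}$ is minimal, i.e. its mean curvature vector (the trace of its second fundamental form $B_M$) vanishes identically. Let $g_{ij}=\delta_{ij}+\sum_{\alpha=1}^m\partial_iu^\alpha\,\partial_ju^\alpha$ be the induced metric, with inverse $(g^{ij})$, and let $v=\sqrt{\det(g_{ij})}$ be the slope of $M$. Functions on $M$ are identified with functions on $\Omega$ through $x\mapsto(x,u(x))$; $\Delta_M f=\frac1v\sum_{i,j}\partial_i(v g^{ij}\partial_jf)$ is the Laplacian of $M$, $|\nabla f|^2=\sum_{i,j}g^{ij}\partial_if\,\partial_jf$ is the squared norm of the gradient on $M$, and $|B_M|^2=\sum_{i,j}|B_M(e_i,e_j)|^2$ for an orthonormal basis $(e_i)$ of the tangent space. Let $x\in\Omega$, let $\lambda_1\ge\cdots\ge\lambda_n\ge0$ be the singular values of $Du(x)$ (so that $\lambda_i^2$ are the eigenvalues of $\left(\sum_\alpha\partial_iu^\alpha\,\partial_ju^\alpha\right)_{ij}$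 at $x$), and suppose that $\lambda_1\lambda_i\le\Lambda$ for all $i\ge2$, for some $0<\Lambda\le\sqrt2$. Then at $x$ $$\Delta_M\log v\ \ge\ \Bigl(1-\frac{\Lambda}{\sqrt2}\Bigr)|B_M|^2+\frac1n|\nabla\log v|^2 .$$ -/

import Mathlib

open scoped ContDiff

noncomputable section

namespace SmoothGraph

/-- The `i`-th partial derivative at `x` of a map on `ℝⁿ`. -/
def partialD {n : ℕ} {F : Type*} [NormedAddCommGroup F] [NormedSpace ℝ F]
    (i : Fin n) (f : EuclideanSpace ℝ (Fin n) → F) (x : EuclideanSpace ℝ (Fin n)) : F :=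
  fderiv ℝ f x (EuclideanSpace.single i 1)

variable {n m : ℕ}

/-- The parametrization `x ↦ (x, u x)` of the graph of `u`, with values in `ℝⁿ × ℝᵐ = ℝⁿ⁺ᵐ`
(Euclidean space with coordinates indexed by `Fin n ⊕ Fin m`). Functions on the graph are
written as functions of `x`. -/
def graphMap (u : EuclideanSpace ℝ (Fin n) → EuclideanSpace ℝ (Fin m))
    (x : EuclideanSpace ℝ (Fin n)) :
    EuclideanSpace ℝ (Fin n ⊕ Fin m) :=
  WithLp.toLp 2 (Sum.elim (fun i => x i) (fun a => u x a))

/-- The induced metric `g_ij = δ_ij + ∑_α ∂_i u^α ∂_j u^α`; its inverse matrix is `(g^ij)`. -/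
def metric (u : EuclideanSpace ℝ (Fin n) → EuclideanSpace ℝ (Fin m))
    (x : EuclideanSpace ℝ (Fin n)) : Matrix (Fin n) (Fin n) ℝ :=
  Matrix.of fun i j => (if i = j then 1 else 0) +
    ∑ a : Fin m, partialD i (fun y => u y a) x * partialD j (fun y => u y a) x

/-- The slope `v = √(det g_ij)`. -/
def slope (u : EuclideanSpace ℝ (Fin n) → EuclideanSpace ℝ (Fin m))
    (x : EuclideanSpace ℝ (Fin n)) : ℝ :=
  Real.sqrt (metric u x).det

/-- The Laplace–Beltrami operator of the induced metric,
`Δ_M f = v⁻¹ ∑_{i,j} ∂_i (v g^{ij} ∂_j f)`. -/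
def laplacian (u : EuclideanSpace ℝ (Fin n) → EuclideanSpace ℝ (Fin m))
    (f : EuclideanSpace ℝ (Fin n) → ℝ) (x : EuclideanSpace ℝ (Fin n)) : ℝ :=
  (slope u x)⁻¹ * ∑ i : Fin n, ∑ j : Fin n,
    partialD i (fun y => slope u y * (metric u y)⁻¹ i j * partialD j f y) x

/-- The squared norm `|∇f|² = ∑_{i,j} g^{ij} ∂_i f ∂_j f` of the gradient on the graph. -/
def gradSq (u : EuclideanSpace ℝ (Fin n) → EuclideanSpace ℝ (Fin m))
    (f : EuclideanSpace ℝ (Fin n) → ℝ) (x : EuclideanSpace ℝ (Fin n)) : ℝ :=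
  ∑ i : Fin n, ∑ j : Fin n, (metric u x)⁻¹ i j * partialD i f x * partialD j f x

/-- The tangent space of the graph at `(x, u x)`, as a subspace of `ℝⁿ⁺ᵐ`. -/
def tangentPlane (u : EuclideanSpace ℝ (Fin n) → EuclideanSpace ℝ (Fin m))
    (x : EuclideanSpace ℝ (Fin n)) :
    Submodule ℝ (EuclideanSpace ℝ (Fin n ⊕ Fin m)) :=
  LinearMap.range (fderiv ℝ (graphMap u) x).toLinearMap

/-- The second fundamental form `B_M(∂_i F, ∂_j F) = (∂_i ∂_j F)^N` for the parametrization
`F(x) = (x, u x)`, where `N` is the orthogonal projection to the normal space. -/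
def secondForm (u : EuclideanSpace ℝ (Fin n) → EuclideanSpace ℝ (Fin m))
    (x : EuclideanSpace ℝ (Fin n)) (i j : Fin n) :
    EuclideanSpace ℝ (Fin n ⊕ Fin m) :=
  (tangentPlane u x)ᗮ.starProjection (partialD i (partialD j (graphMap u)) x)

/-- The squared norm `|B_M|² = ∑ g^{ik} g^{jl} ⟨B_ij, B_kl⟩`, that is, `∑ |B_M(e_i, e_j)|²` for
any orthonormal basis `e_1, …, e_n` of the tangent space. -/
def secondFormSq (u : EuclideanSpace ℝ (Fin n) → EuclideanSpace ℝ (Fin m))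
    (x : EuclideanSpace ℝ (Fin n)) : ℝ :=
  ∑ i : Fin n, ∑ j : Fin n, ∑ k : Fin n, ∑ l : Fin n,
    (metric u x)⁻¹ i k * (metric u x)⁻¹ j l *
      inner ℝ (secondForm u x i j) (secondForm u x k l)

/-- The mean curvature vector `H = ∑ g^{ij} B_ij`, the trace of the second fundamental form. -/
def meanCurvature (u : EuclideanSpace ℝ (Fin n) → EuclideanSpace ℝ (Fin m))
    (x : EuclideanSpace ℝ (Fin n)) :
    EuclideanSpace ℝ (Fin n ⊕ Fin m) :=
  ∑ i : Fin n, ∑ j : Fin n, (metric u x)⁻¹ i j • secondForm u x i j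

/-- The graph of `u` over `Ω` is a smooth minimal graph: `u` is `C^∞` on `Ω`, and the mean
curvature vector of the graph vanishes. -/
def IsSmoothMinimalGraph (Ω : Set (EuclideanSpace ℝ (Fin n)))
    (u : EuclideanSpace ℝ (Fin n) → EuclideanSpace ℝ (Fin m)) : Prop :=
  ContDiffOn ℝ ∞ u Ω ∧ ∀ x ∈ Ω, meanCurvature u x = 0

/-- The singular values `λ_1 ≥ … ≥ λ_n ≥ 0` of `Du` at `x`, indexed from `0`
(`λ_{i+1} = singularValue u x i`) and continued by zero. -/
def singularValue (u : EuclideanSpace ℝ (Fin n) → EuclideanSpace ℝ (Fin m))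
    (x : EuclideanSpace ℝ (Fin n)) (i : ℕ) : ℝ :=
  (fderiv ℝ u x).toLinearMap.singularValues i

end SmoothGraph

end

/-!
The proof is the computation of `Δ_M log v` in a frame adapted to the singular value decomposition
of `Du` at the given point, followed by an algebraic inequality.

Let `e_p` be the right singular vectors of `Du(x)` divided by `√(1 + λ_p²)`. They form a constant
frame which at `x` is orthonormal for the induced metric (`exists_adapted_frame`). All the
quantities of the statement have the same form in the frame `e_p` as in the standard frame, so at
`x` one may compute with `g = 1` (`laplacian_log_slope_eq`, `gradSq_log_slope_eq`,
`secondFormSq_eq`). Vanishing mean curvature is the system `∑ g^{pq} ∂_p ∂_q u = 0`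
(`minimal_surface_system`). It kills the first-order terms of the Laplacian, and its derivative
expresses the trace of the third derivative of `u` through first and second derivatives
(`sum_dirDeriv_third`). With `W_pq = ∂_p ∂_q u`, `a_p = ∂_p u` and `T_{r,pq} = ⟨W_pq, a_r⟩` the result
(`laplacian_log_frame`) is
`Δ_M log v = |B|² + ∑_{k,l,p} T_{k,lp} T_{l,kp}`, where `|B|² = ∑ |W_pq|² - ∑ T_{r,pq}²` and
`∂_p log v = ∑_k T_{k,kp}`.

Now `T_{r,pq} = λ_r h_{r,pq}` with `h_{r,pq}` the components of the second fundamental form along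
unit normals, and `∑ h² ≤ |B|²` by Bessel's inequality. The terms with `k = l` of the sum above are
`∑ (λ_k h_{k,kp})²`, at least `|∇ log v|² / n` by the Cauchy-Schwarz inequality. The remaining terms
are grouped into cyclic orbits of the index triple; each orbit is a quadratic form in three
variables with off-diagonal coefficients in `[0, Λ]`, and is bounded below by `-Λ / √2` times the
sum of squares (`triple_form_nonneg`, `offDiagonal_sum_nonneg`).
-/

namespace SmoothGraph

/-! ### The algebraic inequality -/

/-- The quadratic form with off-diagonal entries in `[0, √2 s]` is bounded below by `-s`. It is
affine in each of the entries, so only the cases where they are `0` or `√2 s` matter. -/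
theorem triple_form_nonneg {s p q r x y z : ℝ} (hs : 0 ≤ s) (hp : 0 ≤ p) (hq : 0 ≤ q)
    (hr : 0 ≤ r) (hp' : p ≤ √2 * s) (hq' : q ≤ √2 * s) (hr' : r ≤ √2 * s) :
    0 ≤ s * (x ^ 2 + y ^ 2 + z ^ 2) + p * (x * y) + q * (y * z) + r * (z * x) := by
  have key : ∀ {k t A B : ℝ}, 0 ≤ t → t ≤ k → 0 ≤ A → 0 ≤ A + k * B → 0 ≤ A + t * B := by
    intro k t A B ht htk hA hAB
    rcases le_total 0 B with hB | hB
    · positivity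
    · nlinarith
  have hw : √2 * √2 = 2 := Real.mul_self_sqrt (by norm_num)
  have hw0 : 0 ≤ √2 := Real.sqrt_nonneg 2
  have hw2 : √2 ≤ 2 := by nlinarith
  have one : ∀ a b c : ℝ, 0 ≤ s * (a ^ 2 + b ^ 2 + c ^ 2) + √2 * s * (a * b) := by
    intro a b c
    have : s * (a ^ 2 + b ^ 2 + c ^ 2) + √2 * s * (a * b) =
        s * ((a + √2 / 2 * b) ^ 2 + b ^ 2 / 2 + c ^ 2) := by
      linear_combination (-s * b ^ 2 / 4) * hw
    rw [this]; positivity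
  have two : ∀ a b c : ℝ, 0 ≤ s * (a ^ 2 + b ^ 2 + c ^ 2) + √2 * s * (a * b) +
      √2 * s * (b * c) := by
    intro a b c
    have : s * (a ^ 2 + b ^ 2 + c ^ 2) + √2 * s * (a * b) + √2 * s * (b * c) =
        s * ((b + √2 / 2 * (a + c)) ^ 2 + (a - c) ^ 2 / 2) := by
      linear_combination (-s * (a + c) ^ 2 / 4) * hw
    rw [this]; positivity
  have three : 0 ≤ s * (x ^ 2 + y ^ 2 + z ^ 2) + √2 * s * (x * y) + √2 * s * (y * z) +
      √2 * s * (z * x) := by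
    have : s * (x ^ 2 + y ^ 2 + z ^ 2) + √2 * s * (x * y) + √2 * s * (y * z) +
        √2 * s * (z * x) =
        s * ((1 - √2 / 2) * (x ^ 2 + y ^ 2 + z ^ 2) + √2 / 2 * (x + y + z) ^ 2) := by ring
    rw [this]
    have : 0 ≤ 1 - √2 / 2 := by linarith
    positivity
  refine key hr hr' (key hq hq' (key hp hp' (by positivity) (one x y z)) ?_) ?_
  · have := key hp hp' (A := s * (x ^ 2 + y ^ 2 + z ^ 2) + √2 * s * (y * z)) (B := x * y)
      (by linarith [one y z x]) (by linarith [two x y z])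
    linarith
  · have h0 := key hp hp' (A := s * (x ^ 2 + y ^ 2 + z ^ 2) + √2 * s * (z * x)) (B := x * y)
      (by linarith [one z x y]) (by linarith [two z x y])
    have h1 := key hp hp' (A := s * (x ^ 2 + y ^ 2 + z ^ 2) + √2 * s * (y * z) +
      √2 * s * (z * x)) (B := x * y) (by linarith [two y z x]) (by linarith [three])
    have := key hq hq' (A := s * (x ^ 2 + y ^ 2 + z ^ 2) + √2 * s * (z * x) + p * (x * y))
      (B := y * z) (by linarith) (by linarith)
    linarith

variable {ι : Type*} [Fintype ι]

/-- A sum over triples of indices is invariant under cyclic permutation of the indices. -/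
theorem sum_cyclic (t : ι → ι → ι → ℝ) :
    ∑ a, ∑ b, ∑ c, t b c a = ∑ a, ∑ b, ∑ c, t a b c := by
  rw [Finset.sum_comm]
  exact Finset.sum_congr rfl fun b _ => Finset.sum_comm

/-- Averaging the left side over cyclic permutations of `(a, b, c)` and using the symmetry of `h`
leaves, for each triple, the form of `triple_form_nonneg` in `h a b c`, `h b c a`, `h c a b`.
Triples with repeated indices need no separate treatment: there the corresponding entries
are zero. -/
theorem offDiagonal_sum_nonneg [DecidableEq ι] {h : ι → ι → ι → ℝ}
    (hsymm : ∀ a b c, h a b c = h a c b) {lam : ι → ℝ} (hlam : ∀ a, 0 ≤ lam a) {s : ℝ}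
    (hs : 0 ≤ s) (hpair : ∀ a b, a ≠ b → lam a * lam b ≤ √2 * s) :
    0 ≤ ∑ a, ∑ b, ∑ c, (s * h a b c ^ 2 +
      if a = b then 0 else lam a * lam b * (h a b c * h b a c)) := by
  set t : ι → ι → ι → ℝ := fun a b c => s * h a b c ^ 2 +
      if a = b then 0 else lam a * lam b * (h a b c * h b a c) with ht
  have hcyc := sum_cyclic t
  have hcyc2 := sum_cyclic fun a b c => t b c a
  have hpos : 0 ≤ ∑ a, ∑ b, ∑ c, (t a b c + t b c a + t c a b) := by
    refine Finset.sum_nonneg fun a _ => Finset.sum_nonneg fun b _ =>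
      Finset.sum_nonneg fun c _ => ?_
    set e : ι → ι → ℝ := fun a b => if a = b then 0 else lam a * lam b
    have he : ∀ a b, 0 ≤ e a b := fun a b => by
      simp only [e]; split_ifs
      · exact le_rfl
      · exact mul_nonneg (hlam a) (hlam b)
    have he' : ∀ a b, e a b ≤ √2 * s := fun a b => by
      simp only [e]; split_ifs with hab
      · positivity
      · exact hpair a b hab
    have hte : ∀ a b c, t a b c = s * h a b c ^ 2 + e a b * (h a b c * h b c a) := by
      intro a b c
      simp only [ht, e, hsymm b a c]
      split_ifs <;> ring
    have := triple_form_nonneg (x := h a b c) (y := h b c a) (z := h c a b) hs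
      (he a b) (he b c) (he c a) (he' a b) (he' b c) (he' c a)
    rw [hte, hte b c a, hte c a b]
    linarith
  simp only [Finset.sum_add_distrib] at hpos
  linarith

/-- Bessel's inequality for an orthogonal family of vectors that may vanish. -/
theorem sum_inner_sq_div_le {F : Type*} [NormedAddCommGroup F] [InnerProductSpace ℝ F]
    [DecidableEq ι] {a : ι → F} {d : ι → ℝ}
    (ha : ∀ p q, inner ℝ (a p) (a q) = if p = q then d p else 0) (w : F) :
    ∑ r, inner ℝ w (a r) ^ 2 / d r ≤ ‖w‖ ^ 2 := by
  have h0 : 0 ≤ ‖w - ∑ r, (inner ℝ w (a r) / d r) • a r‖ ^ 2 := by positivity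
  have h1 : inner ℝ w (∑ r, (inner ℝ w (a r) / d r) • a r) = ∑ r, inner ℝ w (a r) ^ 2 / d r := by
    rw [inner_sum]
    refine Finset.sum_congr rfl fun r _ => ?_
    rw [real_inner_smul_right]; ring
  have h2 : ‖∑ r, (inner ℝ w (a r) / d r) • a r‖ ^ 2 = ∑ r, inner ℝ w (a r) ^ 2 / d r := by
    rw [← real_inner_self_eq_norm_sq, sum_inner]
    refine Finset.sum_congr rfl fun r _ => ?_
    rw [real_inner_smul_left, inner_sum]
    simp only [real_inner_smul_right, ha]
    simp only [mul_ite, mul_zero, Finset.sum_ite_eq, Finset.mem_univ, if_true]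
    rcases eq_or_ne (d r) 0 with h | h
    · simp [h]
    · field_simp
  rw [norm_sub_sq_real, h1, h2] at h0
  linarith

/-- `W` is the second derivative and `a` the first derivative of `u` in a frame which is
orthonormal for the induced metric and diagonalizes `Duᵀ Du`. -/
theorem algebraic_inequality {n : ℕ} {F : Type*} [NormedAddCommGroup F] [InnerProductSpace ℝ F]
    {W : Fin n → Fin n → F} (hW : ∀ p q, W p q = W q p) {a : Fin n → F} {lam : Fin n → ℝ}
    (hlam : ∀ p, 0 ≤ lam p)
    (ha : ∀ p q, inner ℝ (a p) (a q) = if p = q then lam p ^ 2 / (1 + lam p ^ 2) else 0)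
    {Λ : ℝ} (hΛ : 0 ≤ Λ) (hpair : ∀ p q, p ≠ q → lam p * lam q ≤ Λ) :
    (1 - Λ / √2) * (∑ p, ∑ q, (‖W p q‖ ^ 2 - ∑ r, inner ℝ (W p q) (a r) ^ 2)) +
      1 / (n : ℝ) * ∑ p, (∑ k, inner ℝ (W k p) (a k)) ^ 2 ≤
    (∑ p, ∑ q, (‖W p q‖ ^ 2 - ∑ r, inner ℝ (W p q) (a r) ^ 2)) +
      ∑ k, ∑ l, ∑ p, inner ℝ (W l p) (a k) * inner ℝ (W k p) (a l) := by
  -- The components of the second fundamental form along the unit normals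
  -- `(-λ_r p_r, q_r) / √(1 + λ_r ^ 2)`; the value `0` for `λ_r = 0` is harmless, as then `a r = 0`.
  set h : Fin n → Fin n → Fin n → ℝ := fun r p q => inner ℝ (W p q) (a r) / lam r with hh
  have hT : ∀ r p q, inner ℝ (W p q) (a r) = lam r * h r p q := by
    intro r p q
    rcases eq_or_ne (lam r) 0 with h0 | h0
    · have : a r = 0 := by
        have := ha r r
        rw [if_pos rfl, h0] at this
        simpa using this
      simp [this, h0]
    · simp only [hh]; field_simp
  set B := ∑ p, ∑ q, (‖W p q‖ ^ 2 - ∑ r, inner ℝ (W p q) (a r) ^ 2) with hB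
  have hBh : ∑ k, ∑ l, ∑ p, h k l p ^ 2 ≤ B := by
    rw [sum_cyclic fun p q r => h r p q ^ 2, hB]
    refine Finset.sum_le_sum fun p _ => Finset.sum_le_sum fun q _ => ?_
    have hbes := sum_inner_sq_div_le ha (W p q)
    have hterm : ∀ r, inner ℝ (W p q) (a r) ^ 2 / (lam r ^ 2 / (1 + lam r ^ 2)) =
        h r p q ^ 2 + inner ℝ (W p q) (a r) ^ 2 := by
      intro r
      rw [hT]
      rcases eq_or_ne (lam r) 0 with h0 | h0
      · simp [hh, h0]
      · have : 1 + lam r ^ 2 ≠ 0 := by positivity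
        field_simp
    simp only [hterm, Finset.sum_add_distrib] at hbes
    linarith
  set s := Λ / √2 with hs
  have hs0 : 0 ≤ s := by positivity
  have hΛs : √2 * s = Λ := by rw [hs]; field_simp
  have hoff := offDiagonal_sum_nonneg (h := h) (fun r p q => by simp only [hh, hW p q]) hlam hs0
    (fun p q hpq => (hpair p q hpq).trans_eq hΛs.symm)
  have hdiag : 1 / (n : ℝ) * ∑ p, (∑ k, lam k * h k k p) ^ 2 ≤
      ∑ p, ∑ k, (lam k * h k k p) ^ 2 := by
    rw [Finset.mul_sum]
    refine Finset.sum_le_sum fun p _ => ?_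
    rcases Nat.eq_zero_or_pos n with rfl | hn
    · simp
    have := sq_sum_le_card_mul_sum_sq (s := Finset.univ) (f := fun k => lam k * h k k p)
    rw [Finset.card_univ, Fintype.card_fin] at this
    have hn' : (0 : ℝ) < n := by exact_mod_cast hn
    rw [one_div, inv_mul_le_iff₀ hn']
    exact this
  have hsplit : ∑ k, ∑ l, ∑ p, (lam k * h k l p) * (lam l * h l k p) =
      ∑ p, ∑ k, (lam k * h k k p) ^ 2 +
      ∑ k, ∑ l, ∑ p, (if k = l then 0 else lam k * lam l * (h k l p * h l k p)) := by
    rw [Finset.sum_comm (f := fun p k => (lam k * h k k p) ^ 2), ← Finset.sum_add_distrib]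
    refine Finset.sum_congr rfl fun k _ => ?_
    rw [Finset.sum_comm, Finset.sum_comm (f := fun l p => ite _ _ _), ← Finset.sum_add_distrib]
    refine Finset.sum_congr rfl fun p _ => ?_
    rw [← Finset.add_sum_erase _ _ (Finset.mem_univ k),
      ← Finset.add_sum_erase (f := fun l => ite _ _ _) _ (Finset.mem_univ k), if_pos rfl, zero_add]
    congr 1
    · ring
    · refine Finset.sum_congr rfl fun l hl => ?_
      rw [if_neg (Finset.ne_of_mem_erase hl).symm]; ring
  simp only [Finset.sum_add_distrib, ← Finset.mul_sum] at hoff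
  have hsB := mul_le_mul_of_nonneg_left hBh hs0
  simp only [hT]
  rw [hsplit]
  simp only [mul_assoc] at *
  linarith

/-! ### Derivatives in constant directions -/

variable {E F : Type*} [NormedAddCommGroup E] [NormedSpace ℝ E]
  [NormedAddCommGroup F] [InnerProductSpace ℝ F]

/-- The derivative of `f` in the constant direction `v`, as a function of the base point. -/
noncomputable def dirDeriv {F : Type*} [NormedAddCommGroup F] [NormedSpace ℝ F] (v : E) (f : E → F) (x : E) :
    F :=
  fderiv ℝ f x v

theorem contDiffAt_dirDeriv {f : E → F} {x : E} (hf : ContDiffAt ℝ ∞ f x) (v : E) :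
    ContDiffAt ℝ ∞ (dirDeriv v f) x :=
  (hf.fderiv_right (m := ∞) (by simp)).clm_apply contDiffAt_const

theorem _root_.ContDiffAt.diffAt {f : E → F} {x : E} (hf : ContDiffAt ℝ ∞ f x) :
    DifferentiableAt ℝ f x :=
  hf.differentiableAt (by simp)

theorem dirDeriv_dirDeriv {f : E → F} {x : E} (hf : ContDiffAt ℝ ∞ f x) (v w : E) :
    dirDeriv v (dirDeriv w f) x = fderiv ℝ (fderiv ℝ f) x v w := by
  have h : DifferentiableAt ℝ (fderiv ℝ f) x :=
    (hf.fderiv_right (m := ∞) (by simp)).differentiableAt (by simp)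
  change fderiv ℝ (fun y => fderiv ℝ f y w) x v = _
  rw [fderiv_clm_apply h (differentiableAt_const w)]
  simp

theorem dirDeriv_comm {f : E → F} {x : E} (hf : ContDiffAt ℝ ∞ f x) (v w : E) :
    dirDeriv v (dirDeriv w f) x = dirDeriv w (dirDeriv v f) x := by
  rw [dirDeriv_dirDeriv hf, dirDeriv_dirDeriv hf]
  refine hf.isSymmSndFDerivAt ?_ v w
  rw [minSmoothness_of_isRCLikeNormedField]
  exact WithTop.coe_le_coe.2 (le_top : (2 : ℕ∞) ≤ ⊤)

theorem dirDeriv_congr {f g : E → F} {s : Set E} {x : E} (hs : IsOpen s) (hx : x ∈ s)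
    (h : ∀ y ∈ s, f y = g y) (v : E) : dirDeriv v f x = dirDeriv v g x := by
  unfold dirDeriv
  rw [Filter.EventuallyEq.fderiv_eq (Filter.eventually_of_mem (hs.mem_nhds hx) h)]

theorem dirDeriv_sum {ι : Type*} {s : Finset ι} {f : ι → E → F} {x : E}
    (hf : ∀ i ∈ s, DifferentiableAt ℝ (f i) x) (v : E) :
    dirDeriv v (fun y => ∑ i ∈ s, f i y) x = ∑ i ∈ s, dirDeriv v (f i) x := by
  unfold dirDeriv
  rw [fderiv_fun_sum hf, sum_apply]

theorem dirDeriv_smul {c : E → ℝ} {f : E → F} {x : E} (hc : DifferentiableAt ℝ c x)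
    (hf : DifferentiableAt ℝ f x) (v : E) :
    dirDeriv v (fun y => c y • f y) x = dirDeriv v c x • f x + c x • dirDeriv v f x := by
  unfold dirDeriv
  rw [fderiv_fun_smul hc hf]
  simp [add_comm]

theorem dirDeriv_mul {f g : E → ℝ} {x : E} (hf : DifferentiableAt ℝ f x)
    (hg : DifferentiableAt ℝ g x) (v : E) :
    dirDeriv v (fun y => f y * g y) x = dirDeriv v f x * g x + f x * dirDeriv v g x :=
  dirDeriv_smul hf hg v

theorem dirDeriv_const_mul (c : ℝ) {f : E → ℝ} {x : E} (hf : DifferentiableAt ℝ f x) (v : E) :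
    dirDeriv v (fun y => c * f y) x = c * dirDeriv v f x := by
  unfold dirDeriv
  rw [fderiv_const_mul hf]
  simp

theorem dirDeriv_inner {f g : E → F} {x : E} (hf : DifferentiableAt ℝ f x)
    (hg : DifferentiableAt ℝ g x) (v : E) :
    dirDeriv v (fun y => inner ℝ (f y) (g y)) x =
      inner ℝ (f x) (dirDeriv v g x) + inner ℝ (dirDeriv v f x) (g x) :=
  fderiv_inner_apply ℝ hf hg v

/-! ### Derivatives of determinants and inverse matrices -/

variable {n : ℕ} {M : E → Matrix (Fin n) (Fin n) ℝ} {x : E}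

theorem contDiffAt_det (hM : ∀ i j, ContDiffAt ℝ ∞ (fun y => M y i j) x) :
    ContDiffAt ℝ ∞ (fun y => (M y).det) x := by
  simp only [Matrix.det_apply']
  exact ContDiffAt.sum fun σ _ => contDiffAt_const.mul (contDiffAt_prod fun i _ => hM _ _)

theorem contDiffAt_inv (hM : ∀ i j, ContDiffAt ℝ ∞ (fun y => M y i j) x)
    (hdet : (M x).det ≠ 0) (i j : Fin n) : ContDiffAt ℝ ∞ (fun y => (M y)⁻¹ i j) x := by
  simp only [Matrix.inv_def, Ring.inverse_eq_inv', Matrix.smul_apply, smul_eq_mul,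
    Matrix.adjugate_apply]
  refine ((contDiffAt_det hM).inv hdet).mul (contDiffAt_det fun k l => ?_)
  by_cases hk : k = j
  · subst hk; simpa using contDiffAt_const
  · simpa [Matrix.updateRow_ne hk] using hM k l

/-- Jacobi's formula for the derivative of a determinant, in logarithmic form. -/
theorem dirDeriv_log_det (hM : ∀ i j, ContDiffAt ℝ ∞ (fun y => M y i j) x)
    (hdet : (M x).det ≠ 0) (v : E) :
    dirDeriv v (fun y => Real.log (M y).det) x =
      ∑ k, ∑ l, (M x)⁻¹ l k * dirDeriv v (fun y => M y k l) x := by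
  have hdiff : ∀ i j, DifferentiableAt ℝ (fun y => M y i j) x := fun i j => (hM i j).diffAt
  have hrow : ∀ i, HasFDerivAt (fun y => M y i)
      (ContinuousLinearMap.pi fun j => fderiv ℝ (fun y => M y i j) x) x := fun i =>
    hasFDerivAt_pi.2 fun j => (hdiff i j).hasFDerivAt
  let detC : ContinuousMultilinearMap ℝ (fun _ : Fin n => Fin n → ℝ) ℝ :=
    { toMultilinearMap := (Matrix.detRowAlternating (n := Fin n) (R := ℝ)).toMultilinearMap
      cont := Continuous.matrix_det continuous_id }
  have hd : HasFDerivAt (fun y => (M y).det) _ x := HasFDerivAt.multilinear_comp detC hrow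
  unfold dirDeriv
  rw [(hd.log hdet).fderiv]
  simp only [smul_apply, sum_apply,
    ContinuousLinearMap.comp_apply, smul_eq_mul, Finset.mul_sum]
  refine Finset.sum_congr rfl fun k _ => ?_
  have h1 : (detC.toContinuousLinearMap (fun j => M x j) k)
      ((ContinuousLinearMap.pi fun j => fderiv ℝ (fun y => M y k j) x) v) =
      ((M x).updateRow k fun j => fderiv ℝ (fun y => M y k j) x v).det := rfl
  rw [h1, ← Matrix.cramer_transpose_apply, Matrix.cramer_eq_adjugate_mulVec,
    Matrix.inv_def, Ring.inverse_eq_inv']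
  simp only [Matrix.mulVec, dotProduct, Finset.mul_sum, Matrix.smul_apply, smul_eq_mul,
    Matrix.transpose_apply, ← Matrix.adjugate_transpose]
  refine Finset.sum_congr rfl fun l _ => ?_
  ring

theorem dirDeriv_inv_of_eq_one (hM : ∀ i j, ContDiffAt ℝ ∞ (fun y => M y i j) x)
    {s : Set E} (hs : IsOpen s) (hx : x ∈ s) (hdet : ∀ y ∈ s, (M y).det ≠ 0)
    (h1 : M x = 1) (v : E) (i j : Fin n) :
    dirDeriv v (fun y => (M y)⁻¹ i j) x = -dirDeriv v (fun y => M y i j) x := by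
  have hinv := contDiffAt_inv hM (hdet x hx)
  have h0 : dirDeriv v (fun y => ∑ k, M y i k * (M y)⁻¹ k j) x = 0 := by
    rw [dirDeriv_congr hs hx (g := fun _ => (1 : Matrix (Fin n) (Fin n) ℝ) i j)]
    · simp [dirDeriv]
    · intro y hy
      rw [← Matrix.mul_apply, Matrix.mul_nonsing_inv _ (hdet y hy).isUnit]
  rw [dirDeriv_sum (f := fun k y => M y i k * (M y)⁻¹ k j)
    fun k _ => (hM i k).diffAt.mul (hinv k j).diffAt] at h0
  have h2 : ∀ k, dirDeriv v (fun y => M y i k * (M y)⁻¹ k j) x =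
      dirDeriv v (fun y => M y i k) x * (if k = j then 1 else 0) +
        (if i = k then 1 else 0) * dirDeriv v (fun y => (M y)⁻¹ k j) x := by
    intro k
    rw [dirDeriv_mul (hM i k).diffAt (hinv k j).diffAt, h1, inv_one]
    simp only [Matrix.one_apply]
  simp only [h2, Finset.sum_add_distrib] at h0
  simp at h0
  linarith

/-! ### The Laplacian of the logarithm of the slope in an adapted frame -/

variable {E F : Type*} [NormedAddCommGroup E] [InnerProductSpace ℝ E]
  [NormedAddCommGroup F] [InnerProductSpace ℝ F] {n : ℕ}

/-- The matrix of the induced metric of the graph of `u` in the constant frame `e`. -/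
noncomputable def frameMetric (e : Fin n → E) (u : E → F) (y : E) : Matrix (Fin n) (Fin n) ℝ :=
  Matrix.of fun p q => inner ℝ (e p) (e q) + inner ℝ (dirDeriv (e p) u y) (dirDeriv (e q) u y)

variable {e : Fin n → E} {u : E → F} {y : E}

theorem contDiffAt_frameMetric (hu : ContDiffAt ℝ ∞ u y) (p q : Fin n) :
    ContDiffAt ℝ ∞ (fun z => frameMetric e u z p q) y :=
  contDiffAt_const.add ((contDiffAt_dirDeriv hu _).inner ℝ (contDiffAt_dirDeriv hu _))

theorem dirDeriv_frameMetric (hu : ContDiffAt ℝ ∞ u y) (v : E) (p q : Fin n) :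
    dirDeriv v (fun z => frameMetric e u z p q) y =
      inner ℝ (dirDeriv (e p) u y) (dirDeriv v (dirDeriv (e q) u) y) +
      inner ℝ (dirDeriv v (dirDeriv (e p) u) y) (dirDeriv (e q) u y) := by
  rw [← dirDeriv_inner (contDiffAt_dirDeriv hu _).diffAt (contDiffAt_dirDeriv hu _).diffAt]
  unfold dirDeriv
  simp only [frameMetric, Matrix.of_apply]
  rw [fderiv_const_add]
  rfl

variable {Ω : Set E} {x : E}

theorem dirDeriv_log_sqrt_det_frameMetric (hu : ContDiffAt ℝ ∞ u y)
    (hpos : 0 < (frameMetric e u y).det) (v : E) :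
    dirDeriv v (fun z => Real.log √(frameMetric e u z).det) y =
      1 / 2 * ∑ k, ∑ l, (frameMetric e u y)⁻¹ l k *
        dirDeriv v (fun z => frameMetric e u z k l) y := by
  rw [← dirDeriv_log_det (contDiffAt_frameMetric hu) hpos.ne',
    ← dirDeriv_const_mul _
      ((contDiffAt_det (contDiffAt_frameMetric hu)).log hpos.ne').diffAt]
  refine congrArg (fun L : E →L[ℝ] ℝ => L v) (Filter.EventuallyEq.fderiv_eq ?_)
  filter_upwards [(contDiffAt_det (contDiffAt_frameMetric hu)).continuousAt.eventually_const_lt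
    hpos] with z hz
  rw [Real.log_sqrt hz.le]; ring

/-- The derivative of the minimal surface system `∑ g^{pq} ∂_p ∂_q u = 0` expresses the trace of the
third derivative through lower derivatives. -/
theorem sum_dirDeriv_third (hΩ : IsOpen Ω) (hx : x ∈ Ω) (hu : ∀ y ∈ Ω, ContDiffAt ℝ ∞ u y)
    (hdet : ∀ y ∈ Ω, (frameMetric e u y).det ≠ 0) (h1 : frameMetric e u x = 1)
    (hmin : ∀ y ∈ Ω, ∑ p, ∑ q, (frameMetric e u y)⁻¹ p q •
      dirDeriv (e p) (dirDeriv (e q) u) y = 0) (k : Fin n) :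
    ∑ p, dirDeriv (e p) (dirDeriv (e p) (dirDeriv (e k) u)) x =
      ∑ p, ∑ q, dirDeriv (e k) (fun y => frameMetric e u y p q) x •
        dirDeriv (e p) (dirDeriv (e q) u) x := by
  have hG := contDiffAt_frameMetric (e := e) (hu x hx)
  have hinv := contDiffAt_inv hG (hdet x hx)
  have hu2 : ∀ p q, ContDiffAt ℝ ∞ (dirDeriv (e p) (dirDeriv (e q) u)) x := fun p q =>
    contDiffAt_dirDeriv (contDiffAt_dirDeriv (hu x hx) _) _
  have hswap : ∀ p, dirDeriv (e p) (dirDeriv (e p) (dirDeriv (e k) u)) x =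
      dirDeriv (e k) (dirDeriv (e p) (dirDeriv (e p) u)) x := by
    intro p
    rw [dirDeriv_congr hΩ hx (fun y hy => dirDeriv_comm (hu y hy) (e p) (e k)),
      dirDeriv_comm (contDiffAt_dirDeriv (hu x hx) _)]
  have h0 : dirDeriv (e k) (fun y => ∑ p, ∑ q, (frameMetric e u y)⁻¹ p q •
      dirDeriv (e p) (dirDeriv (e q) u) y) x = 0 := by
    rw [dirDeriv_congr hΩ hx (g := fun _ => (0 : F)) hmin]
    simp [dirDeriv]
  have hdiff : ∀ p q, DifferentiableAt ℝ (fun y => (frameMetric e u y)⁻¹ p q •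
      dirDeriv (e p) (dirDeriv (e q) u) y) x := fun p q => (hinv p q).diffAt.smul (hu2 p q).diffAt
  rw [dirDeriv_sum fun p _ => DifferentiableAt.fun_sum fun q _ => hdiff p q] at h0
  have h2 : ∀ p, dirDeriv (e k) (fun y => ∑ q, (frameMetric e u y)⁻¹ p q •
      dirDeriv (e p) (dirDeriv (e q) u) y) x =
      -(∑ q, dirDeriv (e k) (fun y => frameMetric e u y p q) x •
        dirDeriv (e p) (dirDeriv (e q) u) x) +
      dirDeriv (e k) (dirDeriv (e p) (dirDeriv (e p) u)) x := by
    intro p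
    rw [dirDeriv_sum fun q _ => hdiff p q]
    have h3 : ∀ q, dirDeriv (e k) (fun y => (frameMetric e u y)⁻¹ p q •
        dirDeriv (e p) (dirDeriv (e q) u) y) x =
        -(dirDeriv (e k) (fun y => frameMetric e u y p q) x •
          dirDeriv (e p) (dirDeriv (e q) u) x) +
        if p = q then dirDeriv (e k) (dirDeriv (e p) (dirDeriv (e q) u)) x else 0 := by
      intro q
      rw [dirDeriv_smul (hinv p q).diffAt (hu2 p q).diffAt,
        dirDeriv_inv_of_eq_one hG hΩ hx hdet h1, h1, inv_one, Matrix.one_apply, neg_smul]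
      split_ifs <;> simp
    simp only [h3, Finset.sum_add_distrib, Finset.sum_neg_distrib]
    simp
  simp only [h2, Finset.sum_add_distrib, Finset.sum_neg_distrib] at h0
  simp only [hswap]
  exact (neg_add_eq_zero.1 h0).symm

/-- The gradient of `log √(det g)` in a frame orthonormal for the induced metric at `x`. -/
theorem dirDeriv_log_sqrt_det_of_eq_one (hu : ContDiffAt ℝ ∞ u x) (h1 : frameMetric e u x = 1)
    (q : Fin n) :
    dirDeriv (e q) (fun z => Real.log √(frameMetric e u z).det) x =
      ∑ k, inner ℝ (dirDeriv (e k) (dirDeriv (e q) u) x) (dirDeriv (e k) u x) := by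
  rw [dirDeriv_log_sqrt_det_frameMetric hu (by simp [h1]), h1, inv_one]
  simp only [Matrix.one_apply, ite_mul, one_mul, zero_mul, Finset.sum_ite_eq', Finset.mem_univ,
    if_true, dirDeriv_frameMetric hu, Finset.mul_sum]
  refine Finset.sum_congr rfl fun k _ => ?_
  rw [dirDeriv_comm hu (e k), real_inner_comm]
  ring

/-- `T` stands for `⟨∂_p ∂_q u, ∂_r u⟩`, the left side for the squared length of the derivative of
the metric. -/
theorem sum_sq_symmetrized {T : Fin n → Fin n → Fin n → ℝ} (hT : ∀ r p q, T r p q = T r q p) :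
    ∑ p, ∑ k, ∑ l, (T l p k + T k p l) ^ 2 =
      2 * ∑ p, ∑ q, ∑ r, T r p q ^ 2 + 2 * ∑ k, ∑ l, ∑ p, T k l p * T l k p := by
  have h1 : ∀ p, ∑ k, ∑ l, T k p l ^ 2 = ∑ k, ∑ l, T l p k ^ 2 := fun p => Finset.sum_comm
  have h2 : ∑ k, ∑ l, ∑ p, T k l p * T l k p = ∑ p, ∑ k, ∑ l, T l p k * T k p l := by
    rw [← sum_cyclic fun k l p => T k l p * T l k p]
    refine Finset.sum_congr rfl fun p _ => Finset.sum_congr rfl fun k _ =>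
      Finset.sum_congr rfl fun l _ => ?_
    rw [hT k l p, hT l k p, mul_comm]
  rw [h2]
  simp only [add_sq, Finset.sum_add_distrib, h1, mul_assoc, ← Finset.mul_sum]
  ring

/-- The Laplacian of `log √(det g)` at a point where the frame is orthonormal for the induced
metric: the first sum is `|B|²`, the second the quadratic form in `⟨W, a⟩` which has no sign. -/
theorem laplacian_log_frame (hΩ : IsOpen Ω) (hx : x ∈ Ω) (hu : ∀ y ∈ Ω, ContDiffAt ℝ ∞ u y)
    (hpos : ∀ y ∈ Ω, 0 < (frameMetric e u y).det) (h1 : frameMetric e u x = 1)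
    (hmin : ∀ y ∈ Ω, ∑ p, ∑ q, (frameMetric e u y)⁻¹ p q •
      dirDeriv (e p) (dirDeriv (e q) u) y = 0)
    {f : E → ℝ} (hf : f = fun y => Real.log √(frameMetric e u y).det)
    {W : Fin n → Fin n → F} (hW : W = fun p q => dirDeriv (e p) (dirDeriv (e q) u) x)
    {a : Fin n → F} (ha : a = fun p => dirDeriv (e p) u x) :
    ∑ p, dirDeriv (e p) (fun y => ∑ q, √(frameMetric e u y).det * (frameMetric e u y)⁻¹ p q *
      dirDeriv (e q) f y) x =
    (∑ p, ∑ q, (‖W p q‖ ^ 2 - ∑ r, inner ℝ (W p q) (a r) ^ 2)) +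
      ∑ k, ∑ l, ∑ p, inner ℝ (W l p) (a k) * inner ℝ (W k p) (a l) := by
  have hdet : ∀ y ∈ Ω, (frameMetric e u y).det ≠ 0 := fun y hy => (hpos y hy).ne'
  have hG := fun y hy => contDiffAt_frameMetric (e := e) (hu y hy)
  have hinv := fun y hy => contDiffAt_inv (hG y hy) (hdet y hy)
  have hu1 := fun y hy p => contDiffAt_dirDeriv (hu y hy) (e p)
  have hsqrt : ∀ y ∈ Ω, ContDiffAt ℝ ∞ (fun z => √(frameMetric e u z).det) y := fun y hy =>
    (contDiffAt_det (hG y hy)).sqrt (hdet y hy)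
  have hfs : ∀ y ∈ Ω, ContDiffAt ℝ ∞ f y := fun y hy => by
    rw [hf]; exact (hsqrt y hy).log (Real.sqrt_pos.2 (hpos y hy)).ne'
  have hWs : ∀ p q, W p q = W q p := fun p q => by
    simp only [hW]; exact dirDeriv_comm (hu x hx) _ _
  have hinv1 : ∀ v p q, dirDeriv v (fun z => (frameMetric e u z)⁻¹ p q) x =
      -dirDeriv v (fun z => frameMetric e u z p q) x := fun v p q =>
    dirDeriv_inv_of_eq_one (hG x hx) hΩ hx hdet h1 v p q
  have hdG : ∀ k p q, dirDeriv (e k) (fun z => frameMetric e u z p q) x =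
      inner ℝ (W k q) (a p) + inner ℝ (W k p) (a q) := fun k p q => by
    rw [dirDeriv_frameMetric (hu x hx), hW, ha, real_inner_comm]
  have hdf : ∀ q, dirDeriv (e q) f x = ∑ k, inner ℝ (W k q) (a k) := fun q => by
    rw [hf, hW, ha]; exact dirDeriv_log_sqrt_det_of_eq_one (hu x hx) h1 q
  have hWtr : ∑ p, W p p = 0 := by
    have := hmin x hx
    rw [h1, inv_one] at this
    simpa [Matrix.one_apply, hW] using this
  have hdsqrt : ∀ p, dirDeriv (e p) (fun z => √(frameMetric e u z).det) x =
      dirDeriv (e p) f x := fun p => by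
    unfold dirDeriv
    rw [hf, fderiv.log (hsqrt x hx).diffAt (Real.sqrt_pos.2 (hpos x hx)).ne', h1]
    simp
  -- The first-order terms of the Laplacian cancel: the coordinates are harmonic on a minimal graph.
  have hdiv : ∑ p, dirDeriv (e p) (fun y => ∑ q, √(frameMetric e u y).det *
      (frameMetric e u y)⁻¹ p q * dirDeriv (e q) f y) x =
      ∑ p, dirDeriv (e p) (dirDeriv (e p) f) x := by
    have hterm : ∀ p q, dirDeriv (e p) (fun y => √(frameMetric e u y).det *
        (frameMetric e u y)⁻¹ p q * dirDeriv (e q) f y) x =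
        (if p = q then dirDeriv (e p) f x * dirDeriv (e q) f x +
          dirDeriv (e p) (dirDeriv (e q) f) x else 0) -
        (inner ℝ (W p q) (a p) + inner ℝ (W p p) (a q)) * dirDeriv (e q) f x := by
      intro p q
      rw [dirDeriv_mul (f := fun y => √(frameMetric e u y).det * (frameMetric e u y)⁻¹ p q)
          ((hsqrt x hx).diffAt.mul (hinv x hx p q).diffAt)
          (contDiffAt_dirDeriv (hfs x hx) _).diffAt,
        dirDeriv_mul (hsqrt x hx).diffAt (hinv x hx p q).diffAt, hinv1, hdG, hdsqrt, h1, inv_one,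
        Matrix.one_apply]
      simp only [Matrix.det_one, Real.sqrt_one]
      split_ifs <;> ring
    have hsum : ∀ p, dirDeriv (e p) (fun y => ∑ q, √(frameMetric e u y).det *
        (frameMetric e u y)⁻¹ p q * dirDeriv (e q) f y) x =
        ∑ q, dirDeriv (e p) (fun y => √(frameMetric e u y).det *
        (frameMetric e u y)⁻¹ p q * dirDeriv (e q) f y) x := fun p =>
      dirDeriv_sum (fun q _ => ((hsqrt x hx).diffAt.mul (hinv x hx p q).diffAt).mul
        (contDiffAt_dirDeriv (hfs x hx) _).diffAt) _
    have hcancel : ∑ p, ∑ q, (inner ℝ (W p q) (a p) + inner ℝ (W p p) (a q)) *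
        dirDeriv (e q) f x = ∑ q, dirDeriv (e q) f x * dirDeriv (e q) f x := by
      rw [Finset.sum_comm]
      refine Finset.sum_congr rfl fun q _ => ?_
      rw [← Finset.sum_mul, Finset.sum_add_distrib, ← sum_inner, hWtr, inner_zero_left, add_zero,
        ← hdf]
    simp only [hsum, hterm, Finset.sum_sub_distrib, hcancel, Finset.sum_ite_eq, Finset.mem_univ,
      if_true, Finset.sum_add_distrib]
    ring
  have hdfy : ∀ y ∈ Ω, ∀ q, dirDeriv (e q) f y = 1 / 2 * ∑ k, ∑ l, (frameMetric e u y)⁻¹ l k *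
        dirDeriv (e q) (fun z => frameMetric e u z k l) y := fun y hy q => by
    rw [hf]; exact dirDeriv_log_sqrt_det_frameMetric (hu y hy) (hpos y hy) _
  have hddG : ∀ p k, dirDeriv (e p) (dirDeriv (e p) (fun z => frameMetric e u z k k)) x =
      2 * (‖W p k‖ ^ 2 + inner ℝ (dirDeriv (e p) (dirDeriv (e p) (dirDeriv (e k) u)) x) (a k)) := by
    intro p k
    have : ∀ y ∈ Ω, dirDeriv (e p) (fun z => frameMetric e u z k k) y =
        2 * inner ℝ (dirDeriv (e p) (dirDeriv (e k) u) y) (dirDeriv (e k) u y) := fun y hy => by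
      rw [dirDeriv_frameMetric (hu y hy), real_inner_comm]; ring
    have hd2 := contDiffAt_dirDeriv (hu1 x hx k) (e p)
    rw [dirDeriv_congr hΩ hx this, dirDeriv_const_mul _ (hd2.diffAt.inner ℝ (hu1 x hx k).diffAt),
      dirDeriv_inner hd2.diffAt (hu1 x hx k).diffAt, ← real_inner_self_eq_norm_sq, hW, ha]
  have hddf : ∀ p, dirDeriv (e p) (dirDeriv (e p) f) x =
      -(1 / 2) * ∑ k, ∑ l, (inner ℝ (W p k) (a l) + inner ℝ (W p l) (a k)) ^ 2 +
      ∑ k, (‖W p k‖ ^ 2 +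
        inner ℝ (dirDeriv (e p) (dirDeriv (e p) (dirDeriv (e k) u)) x) (a k)) := by
    intro p
    have hdGs := fun k l => contDiffAt_dirDeriv (hG x hx k l) (e p)
    have hprod : ∀ k l, DifferentiableAt ℝ (fun y => (frameMetric e u y)⁻¹ l k *
        dirDeriv (e p) (fun z => frameMetric e u z k l) y) x := fun k l =>
      (hinv x hx l k).diffAt.mul (hdGs k l).diffAt
    have hterm : ∀ k l, dirDeriv (e p) (fun y => (frameMetric e u y)⁻¹ l k *
        dirDeriv (e p) (fun z => frameMetric e u z k l) y) x =
        -(inner ℝ (W p k) (a l) + inner ℝ (W p l) (a k)) ^ 2 +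
        if l = k then dirDeriv (e p) (dirDeriv (e p) (fun z => frameMetric e u z k l)) x
          else 0 := by
      intro k l
      rw [dirDeriv_mul (hinv x hx l k).diffAt (hdGs k l).diffAt, hinv1, hdG, hdG, h1, inv_one,
        Matrix.one_apply]
      split_ifs <;> ring
    rw [dirDeriv_congr hΩ hx fun y hy => hdfy y hy p, dirDeriv_const_mul _
      (DifferentiableAt.fun_sum fun k _ => DifferentiableAt.fun_sum fun l _ => hprod k l),
      dirDeriv_sum fun k _ => DifferentiableAt.fun_sum fun l _ => hprod k l]
    have hsum : ∀ k, dirDeriv (e p) (fun y => ∑ l, (frameMetric e u y)⁻¹ l k *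
        dirDeriv (e p) (fun z => frameMetric e u z k l) y) x = _ := fun k =>
      dirDeriv_sum (fun l _ => hprod k l) _
    simp only [hsum, hterm, Finset.sum_add_distrib, Finset.sum_ite_eq', Finset.mem_univ, if_true,
      hddG, Finset.sum_neg_distrib, ← Finset.mul_sum]
    ring
  have hthird : ∑ p, ∑ k, inner ℝ (dirDeriv (e p) (dirDeriv (e p) (dirDeriv (e k) u)) x) (a k) =
      2 * ∑ k, ∑ l, ∑ p, inner ℝ (W l p) (a k) * inner ℝ (W k p) (a l) := by
    rw [Finset.sum_comm]
    have : ∀ k, ∑ p, inner ℝ (dirDeriv (e p) (dirDeriv (e p) (dirDeriv (e k) u)) x) (a k) =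
        2 * ∑ p, ∑ q, inner ℝ (W p q) (a k) * inner ℝ (W k q) (a p) := by
      intro k
      rw [← sum_inner, sum_dirDeriv_third hΩ hx hu hdet h1 hmin, sum_inner, two_mul]
      nth_rewrite 2 [Finset.sum_comm]
      rw [← Finset.sum_add_distrib]
      refine Finset.sum_congr rfl fun p _ => ?_
      rw [sum_inner, ← Finset.sum_add_distrib]
      refine Finset.sum_congr rfl fun q _ => ?_
      rw [real_inner_smul_left, hdG, hWs q p, hW]
      ring
    simp only [this, ← Finset.mul_sum]
  rw [hdiv]
  simp only [hddf, Finset.sum_add_distrib, hthird, ← Finset.mul_sum]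
  have := sum_sq_symmetrized (T := fun r p q => inner ℝ (W p q) (a r))
    (fun r p q => by simp only [hWs p q])
  rw [this]
  simp only [Finset.sum_sub_distrib]
  ring

/-! ### Change of frame -/

variable {n m : ℕ}

section ChangeOfFrame

variable {E F : Type*} [NormedAddCommGroup E] [InnerProductSpace ℝ E]
  [NormedAddCommGroup F] [InnerProductSpace ℝ F] {e e' : Fin n → E} {u : E → F} {y : E}

theorem dirDeriv_sum_smul {G : Type*} [NormedAddCommGroup G] [NormedSpace ℝ G] (f : E → G)
    (c : Fin n → ℝ) (e : Fin n → E) (y : E) :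
    dirDeriv (∑ i, c i • e i) f y = ∑ i, c i • dirDeriv (e i) f y := by
  simp [dirDeriv]

theorem dirDeriv_dirDeriv_sum_smul (hu : ContDiffAt ℝ ∞ u y) {P : Matrix (Fin n) (Fin n) ℝ}
    (he : ∀ p, e' p = ∑ i, P p i • e i) (p q : Fin n) :
    dirDeriv (e' p) (dirDeriv (e' q) u) y =
      ∑ i, P p i • ∑ j, P q j • dirDeriv (e i) (dirDeriv (e j) u) y := by
  rw [dirDeriv_dirDeriv hu, he, he]
  simp only [map_sum, map_smul, sum_apply, smul_apply, dirDeriv_dirDeriv hu, Finset.smul_sum,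
    smul_smul]
  rw [Finset.sum_comm]
  simp only [mul_comm]

theorem frameMetric_sum_smul {P : Matrix (Fin n) (Fin n) ℝ}
    (he : ∀ p, e' p = ∑ i, P p i • e i) (u : E → F) (y : E) :
    frameMetric e' u y = P * frameMetric e u y * P.transpose := by
  ext p q
  simp only [frameMetric, Matrix.of_apply, he, dirDeriv_sum_smul, Matrix.mul_apply,
    Matrix.transpose_apply, sum_inner, inner_sum, real_inner_smul_left, real_inner_smul_right,
    Finset.sum_mul, ← Finset.sum_add_distrib]
  refine Finset.sum_congr rfl fun j _ => Finset.sum_congr rfl fun i _ => ?_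
  rw [real_inner_comm (e j), real_inner_comm (dirDeriv (e j) u y)]
  ring

theorem inv_eq_transpose_mul_inv_mul {P A : Matrix (Fin n) (Fin n) ℝ} (hP : P.det ≠ 0) :
    A⁻¹ = P.transpose * (P * A * P.transpose)⁻¹ * P := by
  have h1 : IsUnit P.det := hP.isUnit
  have h2 : IsUnit P.transpose.det := by rwa [Matrix.det_transpose]
  rw [Matrix.mul_inv_rev, Matrix.mul_inv_rev, ← mul_assoc, ← mul_assoc, Matrix.mul_nonsing_inv _ h2,
    one_mul, mul_assoc, Matrix.nonsing_inv_mul _ h1, mul_one]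

/-- The contraction of a bilinear expression `X` with `A` does not depend on the frame: passing to the
frame with rows `P`, both the coefficients and `X` transform, and the changes cancel. -/
theorem sum_contraction {V : Type*} [AddCommGroup V] [Module ℝ V] {P H A : Matrix (Fin n) (Fin n) ℝ}
    (hA : A = P.transpose * H * P) (X : Fin n → Fin n → V) :
    ∑ p, ∑ q, H p q • ∑ i, P p i • ∑ j, P q j • X i j = ∑ i, ∑ j, A i j • X i j := by
  simp only [hA, Matrix.mul_apply, Matrix.transpose_apply, Finset.sum_mul, Finset.sum_smul,
    Finset.smul_sum, smul_smul]
  have h1 : ∀ p, ∑ q, ∑ i, ∑ j, (H p q * (P p i * P q j)) • X i j =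
      ∑ i, ∑ j, ∑ q, (H p q * (P p i * P q j)) • X i j := fun p => by
    rw [Finset.sum_comm]
    exact Finset.sum_congr rfl fun i _ => Finset.sum_comm
  simp only [h1]
  rw [Finset.sum_comm]
  refine Finset.sum_congr rfl fun i _ => ?_
  rw [Finset.sum_comm]
  refine Finset.sum_congr rfl fun j _ => ?_
  rw [Finset.sum_comm]
  refine Finset.sum_congr rfl fun q _ => Finset.sum_congr rfl fun p _ => ?_
  congr 1; ring

/-- Contraction with the inverse metric is summation over an orthonormal frame. -/
theorem sum_inner_contraction {V : Type*} [NormedAddCommGroup V] [InnerProductSpace ℝ V]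
    {P A : Matrix (Fin n) (Fin n) ℝ} (hA : A = P.transpose * P) (b c : Fin n → V) :
    ∑ i, ∑ j, A i j * inner ℝ (b i) (c j) =
      ∑ p, inner ℝ (∑ i, P p i • b i) (∑ j, P p j • c j) := by
  have := sum_contraction (H := 1) (P := P) (A := A) (by rw [mul_one, hA])
    (fun i j => inner ℝ (b i) (c j))
  simp only [smul_eq_mul] at this
  rw [← this]
  simp only [Matrix.one_apply, ite_mul, one_mul, zero_mul, Finset.sum_ite_eq, Finset.mem_univ,
    if_true]
  simp only [sum_inner, inner_sum, real_inner_smul_left, real_inner_smul_right, Finset.mul_sum]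
  refine Finset.sum_congr rfl fun p _ => ?_
  rw [Finset.sum_comm]
  refine Finset.sum_congr rfl fun i _ => Finset.sum_congr rfl fun j _ => ?_
  ring

end ChangeOfFrame

/-! ### The geometry of the graph -/

local notation "𝔼" => EuclideanSpace ℝ (Fin n)
local notation "𝔽" => EuclideanSpace ℝ (Fin m)

variable {u : EuclideanSpace ℝ (Fin n) → EuclideanSpace ℝ (Fin m)}
  {Ω : Set (EuclideanSpace ℝ (Fin n))} {x y : EuclideanSpace ℝ (Fin n)}

/-- The standard frame of `ℝⁿ`. -/
noncomputable def stdFrame (n : ℕ) (i : Fin n) : EuclideanSpace ℝ (Fin n) := EuclideanSpace.single i 1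

theorem sum_apply_smul_stdFrame (v : EuclideanSpace ℝ (Fin n)) :
    v = ∑ i, v i • stdFrame n i := by
  ext j
  simp [stdFrame, Pi.single_apply]

theorem metric_eq_frameMetric (hu : ContDiffAt ℝ ∞ u y) :
    metric u y = frameMetric (stdFrame n) u y := by
  have h : ∀ i a, partialD i (fun z => u z a) y = dirDeriv (stdFrame n i) u y a := by
    intro i a
    have : HasFDerivAt (fun z => u z a) ((EuclideanSpace.proj a).comp (fderiv ℝ u y)) y :=
      (EuclideanSpace.proj (𝕜 := ℝ) a).hasFDerivAt.comp y hu.diffAt.hasFDerivAt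
    unfold partialD
    rw [this.fderiv]
    rfl
  ext i j
  simp only [metric, frameMetric, Matrix.of_apply, h, PiLp.inner_apply (𝕜 := ℝ) (x := dirDeriv _ u y)]
  congr 1
  · rw [stdFrame, stdFrame, EuclideanSpace.inner_single_left]
    simp
  · exact Finset.sum_congr rfl fun a _ => by simp [mul_comm]

/-- The identification of `ℝⁿ × ℝᵐ` with `ℝⁿ⁺ᵐ`. The domain carries the supremum norm, so that this
is not an isometry; `inner_sumIncl` takes its place. -/
noncomputable def sumIncl (n m : ℕ) : EuclideanSpace ℝ (Fin n) × EuclideanSpace ℝ (Fin m) →L[ℝ]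
    EuclideanSpace ℝ (Fin n ⊕ Fin m) :=
  LinearMap.toContinuousLinearMap
    { toFun := fun v => WithLp.toLp 2 (Sum.elim (fun i => v.1 i) (fun a => v.2 a))
      map_add' := fun v w => by ext (i | a) <;> simp
      map_smul' := fun c v => by ext (i | a) <;> simp }

theorem sumIncl_inl (v : 𝔼 × 𝔽) (i : Fin n) : sumIncl n m v (Sum.inl i) = v.1 i := rfl

theorem sumIncl_inr (v : 𝔼 × 𝔽) (a : Fin m) : sumIncl n m v (Sum.inr a) = v.2 a := rfl

theorem inner_sumIncl (v w : 𝔼 × 𝔽) :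
    inner ℝ (sumIncl n m v) (sumIncl n m w) = inner ℝ v.1 w.1 + inner ℝ v.2 w.2 := by
  simp only [PiLp.inner_apply, Fintype.sum_sum_type, sumIncl_inl, sumIncl_inr]

theorem sumIncl_injective : Function.Injective (sumIncl n m) := fun v w h => by
  refine Prod.ext ?_ ?_
  · ext i; exact congrArg (fun z => z (Sum.inl i)) h
  · ext a; exact congrArg (fun z => z (Sum.inr a)) h

theorem hasFDerivAt_graphMap (hu : ContDiffAt ℝ ∞ u y) :
    HasFDerivAt (graphMap u)
      ((sumIncl n m).comp ((ContinuousLinearMap.id ℝ _).prod (fderiv ℝ u y))) y :=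
  (sumIncl n m).hasFDerivAt.comp y ((hasFDerivAt_id y).prodMk hu.diffAt.hasFDerivAt)

theorem mem_tangentPlane (hu : ContDiffAt ℝ ∞ u x) {z : EuclideanSpace ℝ (Fin n ⊕ Fin m)} :
    z ∈ tangentPlane u x ↔ ∃ v, sumIncl n m (v, dirDeriv v u x) = z := by
  unfold tangentPlane
  rw [(hasFDerivAt_graphMap hu).fderiv]
  rfl

theorem secondForm_eq (hΩ : IsOpen Ω) (hx : x ∈ Ω) (hu : ∀ y ∈ Ω, ContDiffAt ℝ ∞ u y)
    (i j : Fin n) :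
    secondForm u x i j = (tangentPlane u x)ᗮ.starProjection
      (sumIncl n m (0, dirDeriv (stdFrame n i) (dirDeriv (stdFrame n j) u) x)) := by
  unfold secondForm
  congr 1
  change dirDeriv (stdFrame n i) (dirDeriv (stdFrame n j) (graphMap u)) x = _
  have h : ∀ y ∈ Ω, dirDeriv (stdFrame n j) (graphMap u) y =
      sumIncl n m (stdFrame n j, dirDeriv (stdFrame n j) u y) := fun y hy => by
    unfold dirDeriv
    rw [(hasFDerivAt_graphMap (hu y hy)).fderiv]
    rfl
  rw [dirDeriv_congr hΩ hx h]
  have := (sumIncl n m).hasFDerivAt.comp x ((hasFDerivAt_const (stdFrame n j) x).prodMk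
    (contDiffAt_dirDeriv (hu x hx) (stdFrame n j)).diffAt.hasFDerivAt)
  change fderiv ℝ (sumIncl n m ∘ fun y => (stdFrame n j, dirDeriv (stdFrame n j) u y)) x _ = _
  rw [this.fderiv]
  rfl

/-- The minimal surface system: a graph with vanishing mean curvature satisfies
`∑ g^{ij} ∂_i ∂_j u = 0`, because a tangent vector of the form `(0, w)` vanishes. -/
theorem minimal_surface_system (hΩ : IsOpen Ω) (hx : x ∈ Ω) (hu : ∀ y ∈ Ω, ContDiffAt ℝ ∞ u y)
    (hH : meanCurvature u x = 0) :
    ∑ i, ∑ j, (frameMetric (stdFrame n) u x)⁻¹ i j •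
      dirDeriv (stdFrame n i) (dirDeriv (stdFrame n j) u) x = 0 := by
  set w := ∑ i, ∑ j, (frameMetric (stdFrame n) u x)⁻¹ i j •
      dirDeriv (stdFrame n i) (dirDeriv (stdFrame n j) u) x with hw
  have h : (tangentPlane u x)ᗮ.starProjection
      ((sumIncl n m).comp (ContinuousLinearMap.inr ℝ _ _) w) = 0 := by
    rw [← hH, meanCurvature, hw, metric_eq_frameMetric (hu x hx)]
    simp only [map_sum, map_smul, secondForm_eq hΩ hx hu]
    rfl
  rw [Submodule.starProjection_apply_eq_zero_iff, Submodule.orthogonal_orthogonal,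
    mem_tangentPlane (hu x hx)] at h
  obtain ⟨v, hv⟩ := h
  have hv' := sumIncl_injective hv
  have h1 : v = 0 := congrArg Prod.fst hv'
  have h2 : dirDeriv v u x = w := congrArg Prod.snd hv'
  rw [← h2, h1]
  simp [dirDeriv]

/-- The squared length of the normal part of a vertical vector. -/
theorem norm_sq_normal_part {e : Fin n → EuclideanSpace ℝ (Fin n)} (hu : ContDiffAt ℝ ∞ u x)
    (h1 : frameMetric e u x = 1) (w : EuclideanSpace ℝ (Fin m)) :
    ‖(tangentPlane u x)ᗮ.starProjection (sumIncl n m (0, w))‖ ^ 2 =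
      ‖w‖ ^ 2 - ∑ r, inner ℝ w (dirDeriv (e r) u x) ^ 2 := by
  let t : 𝔼 →ₗ[ℝ] EuclideanSpace ℝ (Fin n ⊕ Fin m) :=
    ((sumIncl n m).comp ((ContinuousLinearMap.id ℝ _).prod (fderiv ℝ u x))).toLinearMap
  have ht : ∀ v, t v = sumIncl n m (v, dirDeriv v u x) := fun v => rfl
  have hon : Orthonormal ℝ (t ∘ e) := by
    rw [orthonormal_iff_ite]
    intro p q
    have := congrFun (congrFun h1 p) q
    rw [Matrix.one_apply] at this
    rw [← this, Function.comp, Function.comp, ht, ht, inner_sumIncl]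
    rfl
  have hli : LinearIndependent ℝ e := hon.linearIndependent.of_comp t
  let b := basisOfLinearIndependentOfCardEqFinrank' e hli (by simp)
  -- Orthogonality to the tangent plane is a linear condition, to be checked on the frame.
  have hproj : (tangentPlane u x).starProjection (sumIncl n m (0, w)) =
      ∑ r, inner ℝ w (dirDeriv (e r) u x) • (t ∘ e) r := by
    refine Submodule.eq_starProjection_of_mem_of_inner_eq_zero (K := tangentPlane u x) ?_ ?_
    · refine Submodule.sum_mem _ fun r _ => Submodule.smul_mem _ _ ?_
      exact (mem_tangentPlane hu).2 ⟨e r, rfl⟩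
    · intro z hz
      obtain ⟨v, rfl⟩ := (mem_tangentPlane hu).1 hz
      have : (innerₛₗ ℝ (sumIncl n m (0, w) -
          ∑ r, inner ℝ w (dirDeriv (e r) u x) • (t ∘ e) r)).comp t = 0 := by
        refine b.ext fun r => ?_
        have hb : b r = e r := by simp [b]
        rw [hb]
        simp only [LinearMap.comp_apply, innerₛₗ_apply_apply, LinearMap.zero_apply]
        rw [inner_sub_left]
        have h2 := hon.inner_left_fintype (fun r => inner ℝ w (dirDeriv (e r) u x)) r
        simp only [Function.comp] at h2 ⊢
        rw [h2, ht, inner_sumIncl]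
        simp
      exact congrArg (fun L => L v) this
  have hsplit := (tangentPlane u x).norm_sq_eq_add_norm_sq_starProjection (sumIncl n m (0, w))
  rw [hproj, ← real_inner_self_eq_norm_sq (∑ r, _), hon.inner_sum,
    ← real_inner_self_eq_norm_sq (sumIncl n m (0, w)), inner_sumIncl] at hsplit
  simp only [inner_zero_left, zero_add, real_inner_self_eq_norm_sq, conj_trivial, ← sq] at hsplit
  linarith

/-- A frame which is orthonormal for the induced metric at `x` and consists of multiples of the
right singular vectors of `Du`. -/
theorem exists_adapted_frame (u : EuclideanSpace ℝ (Fin n) → EuclideanSpace ℝ (Fin m))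
    (x : EuclideanSpace ℝ (Fin n)) :
    ∃ e : Fin n → EuclideanSpace ℝ (Fin n), frameMetric e u x = 1 ∧
      ∀ p q : Fin n, inner ℝ (dirDeriv (e p) u x) (dirDeriv (e q) u x) =
        if p = q then singularValue u x p ^ 2 / (1 + singularValue u x p ^ 2) else 0 := by
  set T := (fderiv ℝ u x).toLinearMap with hT
  have hn : Module.finrank ℝ 𝔼 = n := by simp
  have hS := T.isSymmetric_adjoint_comp_self
  set b := hS.eigenvectorBasis hn with hb
  have hTT : ∀ p q, inner ℝ (T (b p)) (T (b q)) =
      if p = q then singularValue u x p ^ 2 else 0 := by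
    intro p q
    rw [← LinearMap.adjoint_inner_right, ← LinearMap.comp_apply, hS.apply_eigenvectorBasis hn,
      ← T.sq_singularValues_fin hn]
    simp only [RCLike.ofReal_real_eq_id, id]
    rw [real_inner_smul_right, orthonormal_iff_ite.1 b.orthonormal]
    split_ifs with h
    · subst h; rw [mul_one]; rfl
    · simp
  have hpos : ∀ p : Fin n, 0 < 1 + singularValue u x p ^ 2 := fun p => by positivity
  have hA : ∀ p q : Fin n, inner ℝ (dirDeriv ((√(1 + singularValue u x p ^ 2))⁻¹ • b p) u x)
      (dirDeriv ((√(1 + singularValue u x q ^ 2))⁻¹ • b q) u x) =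
        if p = q then singularValue u x p ^ 2 / (1 + singularValue u x p ^ 2) else 0 := by
    intro p q
    have hd : ∀ v, dirDeriv v u x = T v := fun v => rfl
    rw [hd, hd, map_smul, map_smul, real_inner_smul_left, real_inner_smul_right, hTT]
    split_ifs with h
    · subst h
      rw [← mul_assoc, ← mul_inv, Real.mul_self_sqrt (hpos p).le]
      ring
    · simp
  refine ⟨fun p => (√(1 + singularValue u x p ^ 2))⁻¹ • b p, ?_, hA⟩
  ext p q
  simp only [frameMetric, Matrix.of_apply, hA, Matrix.one_apply]
  rw [real_inner_smul_left, real_inner_smul_right, orthonormal_iff_ite.1 b.orthonormal]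
  split_ifs with h
  · subst h
    rw [mul_one, ← mul_inv, Real.mul_self_sqrt (hpos p).le]
    have := (hpos p).ne'
    field_simp
  · simp

/-- The matrix whose rows are the vectors of the frame `e`. -/
noncomputable def frameMatrix (e : Fin n → EuclideanSpace ℝ (Fin n)) : Matrix (Fin n) (Fin n) ℝ :=
  Matrix.of fun p i => e p i

theorem eq_sum_frameMatrix_smul (e : Fin n → EuclideanSpace ℝ (Fin n)) (p : Fin n) :
    e p = ∑ i, frameMatrix e p i • stdFrame n i :=
  sum_apply_smul_stdFrame (e p)

theorem det_frameMetric (e : Fin n → EuclideanSpace ℝ (Fin n))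
    (u : EuclideanSpace ℝ (Fin n) → EuclideanSpace ℝ (Fin m)) (y : EuclideanSpace ℝ (Fin n)) :
    (frameMetric e u y).det = (frameMatrix e).det ^ 2 * (frameMetric (stdFrame n) u y).det := by
  rw [frameMetric_sum_smul (eq_sum_frameMatrix_smul e), Matrix.det_mul, Matrix.det_mul,
    Matrix.det_transpose]
  ring

theorem det_frameMatrix_ne_zero {e : Fin n → EuclideanSpace ℝ (Fin n)}
    (h1 : frameMetric e u x = 1) : (frameMatrix e).det ≠ 0 := by
  intro h0
  have := det_frameMetric e u x
  simp [h0, h1] at this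

/-- Positivity is read off from a frame orthonormal for the induced metric. -/
theorem det_frameMetric_stdFrame_pos (u : EuclideanSpace ℝ (Fin n) → EuclideanSpace ℝ (Fin m))
    (x : EuclideanSpace ℝ (Fin n)) : 0 < (frameMetric (stdFrame n) u x).det := by
  obtain ⟨e, h1, -⟩ := exists_adapted_frame u x
  have h := det_frameMetric e u x
  rw [h1, Matrix.det_one] at h
  by_contra hneg
  nlinarith [sq_nonneg (frameMatrix e).det]

theorem det_frameMetric_pos {e : Fin n → EuclideanSpace ℝ (Fin n)}
    (he : (frameMatrix e).det ≠ 0) (u : EuclideanSpace ℝ (Fin n) → EuclideanSpace ℝ (Fin m))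
    (y : EuclideanSpace ℝ (Fin n)) : 0 < (frameMetric e u y).det := by
  rw [det_frameMetric]
  have := det_frameMetric_stdFrame_pos u y
  positivity

theorem inv_frameMetric_stdFrame {e : Fin n → EuclideanSpace ℝ (Fin n)}
    (he : (frameMatrix e).det ≠ 0) (u : EuclideanSpace ℝ (Fin n) → EuclideanSpace ℝ (Fin m))
    (y : EuclideanSpace ℝ (Fin n)) :
    (frameMetric (stdFrame n) u y)⁻¹ =
      (frameMatrix e).transpose * (frameMetric e u y)⁻¹ * frameMatrix e := by
  rw [frameMetric_sum_smul (eq_sum_frameMatrix_smul e)]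
  exact inv_eq_transpose_mul_inv_mul he

/-! ### The operators of the graph in a frame -/

variable {n m : ℕ} {u : EuclideanSpace ℝ (Fin n) → EuclideanSpace ℝ (Fin m)}
  {Ω : Set (EuclideanSpace ℝ (Fin n))} {x y : EuclideanSpace ℝ (Fin n)}
  {e : Fin n → EuclideanSpace ℝ (Fin n)}

theorem slope_eq (hu : ContDiffAt ℝ ∞ u y) (he : (frameMatrix e).det ≠ 0) :
    slope u y = |(frameMatrix e).det|⁻¹ * √(frameMetric e u y).det := by
  rw [slope, metric_eq_frameMetric hu, det_frameMetric e, Real.sqrt_mul (sq_nonneg _),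
    Real.sqrt_sq_eq_abs, inv_mul_cancel_left₀ (abs_ne_zero.2 he)]

theorem dirDeriv_log_slope (hΩ : IsOpen Ω) (hy : y ∈ Ω) (hu : ∀ y ∈ Ω, ContDiffAt ℝ ∞ u y)
    (he : (frameMatrix e).det ≠ 0) (v : EuclideanSpace ℝ (Fin n)) :
    dirDeriv v (fun z => Real.log (slope u z)) y =
      dirDeriv v (fun z => Real.log √(frameMetric e u z).det) y := by
  rw [dirDeriv_congr hΩ hy (g := fun z => Real.log |(frameMatrix e).det|⁻¹ +
    Real.log √(frameMetric e u z).det)]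
  · unfold dirDeriv
    rw [fderiv_const_add]
  · intro z hz
    rw [slope_eq (hu z hz) he, Real.log_mul (inv_ne_zero (abs_ne_zero.2 he))
      (Real.sqrt_pos.2 (det_frameMetric_pos he u z)).ne']

/-- The divergence form of the Laplacian in a constant frame: the constant factor between the two
volume densities cancels. -/
theorem laplacian_log_slope_eq (hΩ : IsOpen Ω) (hx : x ∈ Ω)
    (hu : ∀ y ∈ Ω, ContDiffAt ℝ ∞ u y) (h1 : frameMetric e u x = 1)
    {f : EuclideanSpace ℝ (Fin n) → ℝ} (hf : f = fun y => Real.log √(frameMetric e u y).det) :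
    laplacian u (fun y => Real.log (slope u y)) x =
      ∑ p, dirDeriv (e p) (fun y => ∑ q, √(frameMetric e u y).det * (frameMetric e u y)⁻¹ p q *
        dirDeriv (e q) f y) x := by
  have he := det_frameMatrix_ne_zero h1
  have hpos := det_frameMetric_pos he u
  set c := |(frameMatrix e).det|⁻¹ with hc
  have hc0 : c ≠ 0 := inv_ne_zero (abs_ne_zero.2 he)
  have hG := contDiffAt_frameMetric (e := e) (hu x hx)
  have hsqrt : ContDiffAt ℝ ∞ (fun z => √(frameMetric e u z).det) x :=
    (contDiffAt_det hG).sqrt (hpos x).ne'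
  have hfs : ∀ v, ContDiffAt ℝ ∞ (dirDeriv v f) x := fun v => by
    rw [hf]; exact contDiffAt_dirDeriv (hsqrt.log (Real.sqrt_pos.2 (hpos x)).ne') v
  have hflux : ∀ p, DifferentiableAt ℝ (fun y => ∑ q, √(frameMetric e u y).det *
      (frameMetric e u y)⁻¹ p q * dirDeriv (e q) f y) x := fun p =>
    DifferentiableAt.fun_sum fun q _ =>
      (hsqrt.diffAt.mul (contDiffAt_inv hG (hpos x).ne' p q).diffAt).mul (hfs _).diffAt
  have hstd : ∀ i j, dirDeriv (stdFrame n i)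
      (fun y => slope u y * (metric u y)⁻¹ i j * partialD j (fun y => Real.log (slope u y)) y) x =
      dirDeriv (stdFrame n i) (fun y => c * √(frameMetric e u y).det *
        (frameMetric (stdFrame n) u y)⁻¹ i j * dirDeriv (stdFrame n j) f y) x := fun i j =>
    dirDeriv_congr hΩ hx (fun y hy => by
      rw [slope_eq (hu y hy) he, metric_eq_frameMetric (hu y hy), hf,
        ← dirDeriv_log_slope hΩ hy hu he]
      rfl) _
  have hflux_std : ∀ i y, ∑ j, c * √(frameMetric e u y).det *
      (frameMetric (stdFrame n) u y)⁻¹ i j * dirDeriv (stdFrame n j) f y =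
      ∑ p, c * frameMatrix e p i * ∑ q, √(frameMetric e u y).det * (frameMetric e u y)⁻¹ p q *
        dirDeriv (e q) f y := by
    intro i y
    have hq : ∀ q, dirDeriv (e q) f y =
        ∑ j, frameMatrix e q j * dirDeriv (stdFrame n j) f y := fun q => by
      conv_lhs => rw [eq_sum_frameMatrix_smul e q, dirDeriv_sum_smul]
      rfl
    simp only [hq, inv_frameMetric_stdFrame he, Matrix.mul_apply, Matrix.transpose_apply,
      Finset.mul_sum, Finset.sum_mul]
    rw [Finset.sum_comm]
    rw [Finset.sum_congr rfl fun q _ => Finset.sum_comm, Finset.sum_comm]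
    refine Finset.sum_congr rfl fun p _ => Finset.sum_congr rfl fun q _ =>
      Finset.sum_congr rfl fun j _ => ?_
    ring
  have hdiff_std : ∀ i j, DifferentiableAt ℝ (fun y => c * √(frameMetric e u y).det *
      (frameMetric (stdFrame n) u y)⁻¹ i j * dirDeriv (stdFrame n j) f y) x := fun i j =>
    ((hsqrt.diffAt.const_mul c).mul (contDiffAt_inv (contDiffAt_frameMetric (hu x hx))
      (det_frameMetric_stdFrame_pos u x).ne' i j).diffAt).mul (hfs _).diffAt
  have hrow : ∀ i, ∑ j, dirDeriv (stdFrame n i) (fun y => c * √(frameMetric e u y).det *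
      (frameMetric (stdFrame n) u y)⁻¹ i j * dirDeriv (stdFrame n j) f y) x =
      ∑ p, c * frameMatrix e p i * dirDeriv (stdFrame n i) (fun y => ∑ q,
        √(frameMetric e u y).det * (frameMetric e u y)⁻¹ p q * dirDeriv (e q) f y) x := by
    intro i
    rw [← dirDeriv_sum fun j _ => hdiff_std i j,
      dirDeriv_congr hΩ hx fun y _ => hflux_std i y, dirDeriv_sum fun p _ => (hflux p).const_mul _]
    exact Finset.sum_congr rfl fun p _ => dirDeriv_const_mul _ (hflux p) _
  have hslope : slope u x = c := by rw [slope_eq (hu x hx) he, h1]; simp [hc]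
  unfold laplacian
  rw [hslope]
  change c⁻¹ * ∑ i, ∑ j, dirDeriv (stdFrame n i) (fun y => slope u y * (metric u y)⁻¹ i j *
    partialD j (fun y => Real.log (slope u y)) y) x = _
  simp only [hstd, hrow]
  rw [Finset.sum_comm, Finset.mul_sum]
  refine Finset.sum_congr rfl fun p _ => ?_
  conv_rhs => rw [eq_sum_frameMatrix_smul e p, dirDeriv_sum_smul]
  simp only [smul_eq_mul, mul_assoc, ← Finset.mul_sum]
  rw [inv_mul_cancel_left₀ hc0]

theorem gradSq_log_slope_eq (hΩ : IsOpen Ω) (hx : x ∈ Ω) (hu : ∀ y ∈ Ω, ContDiffAt ℝ ∞ u y)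
    (h1 : frameMetric e u x = 1) :
    gradSq u (fun y => Real.log (slope u y)) x =
      ∑ p, (∑ k, inner ℝ (dirDeriv (e k) (dirDeriv (e p) u) x) (dirDeriv (e k) u x)) ^ 2 := by
  have he := det_frameMatrix_ne_zero h1
  set f := fun y => Real.log (slope u y) with hf
  have hg : (metric u x)⁻¹ = (frameMatrix e).transpose * frameMatrix e := by
    rw [metric_eq_frameMetric (hu x hx), inv_frameMetric_stdFrame he, h1, inv_one, mul_one]
  have hD : ∀ p, ∑ i, frameMatrix e p i • dirDeriv (stdFrame n i) f x =
      ∑ k, inner ℝ (dirDeriv (e k) (dirDeriv (e p) u) x) (dirDeriv (e k) u x) := fun p => by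
    rw [← dirDeriv_sum_smul, ← eq_sum_frameMatrix_smul, hf, dirDeriv_log_slope hΩ hx hu he,
      dirDeriv_log_sqrt_det_of_eq_one (hu x hx) h1]
  have := sum_inner_contraction hg (fun i => dirDeriv (stdFrame n i) f x)
    (fun i => dirDeriv (stdFrame n i) f x)
  simp only [hD, real_inner_self_eq_norm_sq, Real.norm_eq_abs, sq_abs] at this
  rw [← this]
  refine Finset.sum_congr rfl fun i _ => Finset.sum_congr rfl fun j _ => ?_
  rw [mul_assoc]
  congr 1
  exact mul_comm _ _

theorem secondFormSq_eq (hΩ : IsOpen Ω) (hx : x ∈ Ω) (hu : ∀ y ∈ Ω, ContDiffAt ℝ ∞ u y)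
    (h1 : frameMetric e u x = 1) :
    secondFormSq u x = ∑ p, ∑ q, (‖dirDeriv (e p) (dirDeriv (e q) u) x‖ ^ 2 -
      ∑ r, inner ℝ (dirDeriv (e p) (dirDeriv (e q) u) x) (dirDeriv (e r) u x) ^ 2) := by
  have he := det_frameMatrix_ne_zero h1
  have hg : (metric u x)⁻¹ = (frameMatrix e).transpose * frameMatrix e := by
    rw [metric_eq_frameMetric (hu x hx), inv_frameMetric_stdFrame he, h1, inv_one, mul_one]
  have hB : ∀ p q, ∑ i, frameMatrix e p i • ∑ j, frameMatrix e q j • secondForm u x i j =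
      (tangentPlane u x)ᗮ.starProjection
        (sumIncl n m (0, dirDeriv (e p) (dirDeriv (e q) u) x)) := by
    intro p q
    rw [dirDeriv_dirDeriv_sum_smul (hu x hx) (eq_sum_frameMatrix_smul e)]
    have hL : ∀ w, (tangentPlane u x)ᗮ.starProjection (sumIncl n m (0, w)) =
      ((tangentPlane u x)ᗮ.starProjection.comp
        ((sumIncl n m).comp (ContinuousLinearMap.inr ℝ _ _))) w := fun _ => rfl
    simp only [secondForm_eq hΩ hx hu, hL, map_sum, map_smul]
  have hnorm : ∀ p q, ‖dirDeriv (e p) (dirDeriv (e q) u) x‖ ^ 2 -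
      ∑ r, inner ℝ (dirDeriv (e p) (dirDeriv (e q) u) x) (dirDeriv (e r) u x) ^ 2 =
      inner ℝ (∑ i, frameMatrix e p i • ∑ j, frameMatrix e q j • secondForm u x i j)
        (∑ i, frameMatrix e p i • ∑ j, frameMatrix e q j • secondForm u x i j) := fun p q => by
    rw [← norm_sq_normal_part (hu x hx) h1, hB, real_inner_self_eq_norm_sq]
  simp only [hnorm]
  rw [Finset.sum_comm]
  simp only [← sum_inner_contraction hg]
  rw [Finset.sum_comm]
  unfold secondFormSq
  refine Finset.sum_congr rfl fun i _ => ?_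
  rw [Finset.sum_comm]
  conv_rhs => rw [Finset.sum_comm]
  refine Finset.sum_congr rfl fun k _ => ?_
  rw [← Finset.mul_sum, ← sum_inner_contraction hg]
  simp only [Finset.mul_sum, mul_assoc]

end SmoothGraph

theorem mainTheorem10 (n m : ℕ) (hn : 1 ≤ n) (hm : 1 ≤ m)
    (Ω : Set (EuclideanSpace ℝ (Fin n))) (hΩ : IsOpen Ω)
    (u : EuclideanSpace ℝ (Fin n) → EuclideanSpace ℝ (Fin m))
    (hu : SmoothGraph.IsSmoothMinimalGraph Ω u)
    (x : EuclideanSpace ℝ (Fin n)) (hx : x ∈ Ω)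
    (Λ : ℝ) (hΛ : 0 < Λ) (hΛ2 : Λ ≤ √2)
    (hdil : ∀ i : ℕ, 1 ≤ i → i < n →
      SmoothGraph.singularValue u x 0 * SmoothGraph.singularValue u x i ≤ Λ) :
    (1 - Λ / √2) * SmoothGraph.secondFormSq u x +
        1 / (n : ℝ) * SmoothGraph.gradSq u (fun y => Real.log (SmoothGraph.slope u y)) x ≤
      SmoothGraph.laplacian u (fun y => Real.log (SmoothGraph.slope u y)) x := by
  open SmoothGraph in
  have hus : ∀ y ∈ Ω, ContDiffAt ℝ ∞ u y := fun y hy => hu.1.contDiffAt (hΩ.mem_nhds hy)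
  obtain ⟨e, h1, ha⟩ := exists_adapted_frame u x
  have he := det_frameMatrix_ne_zero h1
  have hmin : ∀ y ∈ Ω, ∑ p, ∑ q, (frameMetric e u y)⁻¹ p q •
      dirDeriv (e p) (dirDeriv (e q) u) y = 0 := fun y hy => by
    rw [← minimal_surface_system hΩ hy hus (hu.2 y hy),
      ← sum_contraction (inv_frameMetric_stdFrame he u y)]
    simp only [← dirDeriv_dirDeriv_sum_smul (hus y hy) (eq_sum_frameMatrix_smul e)]
  have hlam : ∀ i : ℕ, 0 ≤ singularValue u x i := fun i => LinearMap.singularValues_nonneg _ i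
  have hanti : Antitone (singularValue u x) := LinearMap.singularValues_antitone _
  have hpair : ∀ p q : Fin n, p ≠ q → singularValue u x p * singularValue u x q ≤ Λ := by
    have hlt : ∀ p q : Fin n, p < q → singularValue u x p * singularValue u x q ≤ Λ :=
      fun p q hpq => (mul_le_mul_of_nonneg_right (hanti (Nat.zero_le p)) (hlam q)).trans
        (hdil q (Nat.succ_le_of_lt ((Nat.zero_le _).trans_lt hpq)) q.2)
    intro p q hpq
    rcases lt_or_gt_of_ne hpq with h | h
    · exact hlt p q h
    · rw [mul_comm]; exact hlt q p h
  rw [secondFormSq_eq hΩ hx hus h1, gradSq_log_slope_eq hΩ hx hus h1,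
    laplacian_log_slope_eq hΩ hx hus h1 rfl,
    laplacian_log_frame hΩ hx hus (fun y _ => det_frameMetric_pos he u y) h1 hmin rfl rfl rfl]
  exact algebraic_inequality (fun p q => dirDeriv_comm (hus x hx) _ _) (fun p => hlam p) ha hΛ.le
    hpair
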